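/- Fix a prime number $p$. All rings are commutative with unit. A \emph{tower of rings} $\{R_i,t_i\}_{i\ge 0}$ is a sequence of ring homomorphisms $R_0\xrightarrow{t_0}R_1\xrightarrow{t_1}R_2\to\cdots$; a morphism of towers $\{R_i,t_i\}\to\{S_i,u_i\}$ is a family of ring homomorphisms $\alpha_i\colon R_i\to S_i$ with $u_i\alpha_i=\alpha_{i+1}t_i$. For an ideal $I_0\subset R=R_0$, write $(R_i)_{\mathrm{tor}}$ for the ideal of those $x\in R_i$ such that for every $a\in I_0$ there is $n>0$ with $a^nx=0$. A tower $\{R_i,t_i\}$ is a \emph{preperfectoid tower arising from} $(R,I_0)$, where $I_0\subset R=R_0$ is an ideal, if: \begin{itemize} \item $p\in I_0$, and for every $i\ge0$ the map $\overline{t_i}\colon R_i/I_0R_i\to R_{i+1}/I_0R_{i+1}$ induced by $t_i$ is injective and its image contains the image of the Frobenius $x\mapsto x^p$ of $R_{i+1}/I_0R_{i+1}$; thus the Frobenius factors as $\overline{t_i}\circ F_i$ for a unique ring homomorphism $F_i\colon R_{i+1}/I_0R_{i+1}\to R_i/I_0R_i$; \item every $F_i$ is surjective; \item $I_0$ is principal,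 and there is a principal ideal $I_1\subset R_1$ with $I_1^p=I_0R_1$ and $\operatorname{Ker}(F_i)=I_1(R_{i+1}/I_0R_{i+1})$ for all $i\ge0$ (such an $I_1$ is unique); \item for every $i\ge 0$, $I_0(R_i)_{\mathrm{tor}}=0$, and there is a bijection $(R_{i+1})_{\mathrm{tor}}\to(R_i)_{\mathrm{tor}}$ compatible with $F_i$ via the maps $(R_j)_{\mathrm{tor}}\hookrightarrow R_j\twoheadrightarrow R_j/I_0R_j$ for $j=i,i+1$. \end{itemize} Its $i$-th \emph{small tilt} is the inverse limit $$R_i^{s.\flat}=\varprojlim\bigl(\cdots\xrightarrow{F_{i+1}}R_{i+1}/I_0R_{i+1}\xrightarrow{F_i}R_i/I_0R_i\bigr).$$ Let $\{R_i\}$ and $\{S_i\}$ be preperfectoid towers arising from $(R,I_0)$ and $(S,J_0)$, with associated ideals $I_1\subset R_1$ and $J_1\subset S_1$, and let $\{\alpha_i\}\colon\{R_i\}\to\{S_i\}$ be a morphism of towers such that $J_0=I_0S$ and $J_1=I_1S_1$. Let $\alpha_i^{s.\flat}\colon R_i^{s.\flat}\to S_i^{s.\flat}$ be the ring homomorphism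 induced on inverse limits by the maps $R_{i+m}/I_0R_{i+m}\to S_{i+m}/J_0S_{i+m}$, $m\ge0$. Fix $i\ge 0$ and assume one of the following: \begin{enumerate} \item $R_i$ and $S_i$ are Noetherian, and $I_0S_i$ is contained in the Jacobson radical of $S_i$; \item $R_i$ is Noetherian and $I_0R_i$-adically complete and separated, and $S_i$ is $I_0S_i$-adically complete and separated. \end{enumerate} Then $\alpha_i\colon R_i\to S_i$ is flat if and only if $\alpha_i^{s.\flat}\colon R_i^{s.\flat}\to S_i^{s.\flat}$ is flat. -/

import Mathlib

universe u v

/-- A tower of (commutative) rings `R 0 → R 1 → R 2 → ⋯`. -/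
structure RingTower where
  obj : ℕ → Type u
  [commRing : ∀ i, CommRing (obj i)]
  map : ∀ i, obj i →+* obj (i + 1)

namespace RingTower

attribute [instance] RingTower.commRing

/-- A morphism of towers, i.e. of inductive systems of rings. -/
structure Hom (R : RingTower.{u}) (S : RingTower.{v}) where
  app : ∀ i, R.obj i →+* S.obj i
  comm : ∀ i, (S.map i).comp (app i) = (app (i + 1)).comp (R.map i)

section Basic

variable (R : RingTower.{u})

/-- The composite transition map `R i → R j` for `i ≤ j`. -/
def transition {i j : ℕ} (h : i ≤ j) : R.obj i →+* R.obj j :=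
  Nat.leRec (motive := fun k _ => R.obj i →+* R.obj k) (RingHom.id _)
    (fun k _ f => (R.map k).comp f) h

theorem transition_self (i : ℕ) : R.transition (le_refl i) = RingHom.id (R.obj i) :=
  Nat.leRec_self _ _

theorem transition_succ {i j : ℕ} (h : i ≤ j) :
    R.transition (Nat.le_succ_of_le h) = (R.map j).comp (R.transition h) :=
  Nat.leRec_succ _ _ h

/-- The ideal `I R_i` of `R_i` generated by an ideal `I` of `R_0`. -/
def extend (I : Ideal (R.obj 0)) (i : ℕ) : Ideal (R.obj i) :=
  I.map (R.transition (Nat.zero_le i))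

theorem extend_succ (I : Ideal (R.obj 0)) (i : ℕ) :
    R.extend I (i + 1) = (R.extend I i).map (R.map i) := by
  unfold extend
  rw [Ideal.map_map, ← transition_succ]

/-- The quotient ring `R_i / I R_i`. -/
abbrev Red (I : Ideal (R.obj 0)) (i : ℕ) : Type u := R.obj i ⧸ R.extend I i

/-- The map `R_i / I R_i → R_{i+1} / I R_{i+1}` induced by the transition map. -/
def redMap (I : Ideal (R.obj 0)) (i : ℕ) : R.Red I i →+* R.Red I (i + 1) :=
  Ideal.quotientMap _ (R.map i) (Ideal.map_le_iff_le_comap.mp (R.extend_succ I i).ge)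

@[simp] theorem redMap_mk (I : Ideal (R.obj 0)) (i : ℕ) (x : R.obj i) :
    R.redMap I i (Ideal.Quotient.mk _ x) = Ideal.Quotient.mk _ (R.map i x) :=
  Ideal.quotientMap_mk

/-- The ideal of `I`-torsion elements of `R_i` (viewed as an `R_0`-module): those `x` such that
every `a ∈ I` has a positive power killing `x`. -/
def torsion (I : Ideal (R.obj 0)) (i : ℕ) : Ideal (R.obj i) where
  carrier := {x | ∀ a ∈ I, ∃ n : ℕ, 0 < n ∧ R.transition (Nat.zero_le i) a ^ n * x = 0}
  zero_mem' := fun _ _ => ⟨1, one_pos, mul_zero _⟩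
  add_mem' := by
    intro x y hx hy a ha
    obtain ⟨n, hn, hnx⟩ := hx a ha
    obtain ⟨m, -, hmy⟩ := hy a ha
    refine ⟨n + m, by omega, ?_⟩
    rw [pow_add, mul_add]
    linear_combination R.transition (Nat.zero_le i) a ^ m * hnx
      + R.transition (Nat.zero_le i) a ^ n * hmy
  smul_mem' := by
    intro c x hx a ha
    obtain ⟨n, hn, hnx⟩ := hx a ha
    refine ⟨n, hn, ?_⟩
    rw [smul_eq_mul]
    linear_combination c * hnx

end Basic

/-- `R` is a purely inseparable tower arising from the pair `(R_0, I)`. -/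
structure IsPurelyInseparable (p : ℕ) (R : RingTower.{u}) (I : Ideal (R.obj 0)) : Prop where
  p_mem : (p : R.obj 0) ∈ I
  redMap_injective : ∀ i, Function.Injective (R.redMap I i)
  pow_mem_range : ∀ i (x : R.Red I (i + 1)), x ^ p ∈ (R.redMap I i).range

section Frobenius

variable {p : ℕ} {R : RingTower.{u}} {I : Ideal (R.obj 0)}

theorem IsPurelyInseparable.natCast_eq_zero (h : R.IsPurelyInseparable p I) (i : ℕ) :
    (p : R.Red I i) = 0 := by
  have h1 := Ideal.mem_map_of_mem (R.transition (Nat.zero_le i)) h.p_mem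
  rw [map_natCast] at h1
  have h2 := Ideal.Quotient.eq_zero_iff_mem.mpr h1
  rwa [map_natCast] at h2

theorem IsPurelyInseparable.add_pow (h : R.IsPurelyInseparable p I) (hp : p.Prime) (i : ℕ)
    (x y : R.Red I i) : (x + y) ^ p = x ^ p + y ^ p := by
  obtain ⟨r, hr⟩ := exists_add_pow_prime_eq hp x y
  rw [hr, h.natCast_eq_zero i]
  ring

variable [Fact p.Prime]

/-- The `i`-th Frobenius projection `F_i : R_{i+1} / I R_{i+1} → R_i / I R_i`: the factorisation
of the Frobenius `x ↦ x ^ p` of `R_{i+1} / I R_{i+1}` through the injective map `redMap`. -/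
noncomputable def frobProj (h : R.IsPurelyInseparable p I) (i : ℕ) :
    R.Red I (i + 1) →+* R.Red I i where
  toFun x := (h.pow_mem_range i x).choose
  map_one' := h.redMap_injective i <| by
    rw [(h.pow_mem_range i 1).choose_spec, one_pow, map_one]
  map_mul' x y := h.redMap_injective i <| by
    rw [map_mul, (h.pow_mem_range i (x * y)).choose_spec, (h.pow_mem_range i x).choose_spec,
      (h.pow_mem_range i y).choose_spec, mul_pow]
  map_zero' := h.redMap_injective i <| by
    rw [(h.pow_mem_range i 0).choose_spec, zero_pow (Fact.out : p.Prime).ne_zero, map_zero]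
  map_add' x y := h.redMap_injective i <| by
    rw [map_add, (h.pow_mem_range i (x + y)).choose_spec, (h.pow_mem_range i x).choose_spec,
      (h.pow_mem_range i y).choose_spec, h.add_pow Fact.out]

theorem redMap_frobProj (h : R.IsPurelyInseparable p I) (i : ℕ) (x : R.Red I (i + 1)) :
    R.redMap I i (frobProj h i x) = x ^ p :=
  (h.pow_mem_range i x).choose_spec

/-- The ideal `I₁` of `R_1` is principal, `I₁ ^ p = I R_1`, and
`Ker F_i = I₁ (R_{i+1} / I R_{i+1})` for every `i`. There is at most one such `I₁`. -/
structure IsFirstPillar (h : R.IsPurelyInseparable p I) (I₁ : Ideal (R.obj 1)) : Prop where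
  isPrincipal : I₁.IsPrincipal
  pow_eq : I₁ ^ p = R.extend I 1
  ker_eq : ∀ i, RingHom.ker (frobProj h i) =
    (I₁.map (R.transition (Nat.le_add_left 1 i))).map (Ideal.Quotient.mk (R.extend I (i + 1)))

end Frobenius

/-- `R` is a preperfectoid tower arising from the pair `(R_0, I)`. -/
structure IsPreperfectoid (p : ℕ) [Fact p.Prime] (R : RingTower.{u}) (I : Ideal (R.obj 0)) : Prop
    extends IsPurelyInseparable p R I where
  frobProj_surjective : ∀ i, Function.Surjective (frobProj toIsPurelyInseparable i)
  isPrincipal : I.IsPrincipal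
  exists_firstPillar : ∃ I₁ : Ideal (R.obj 1), IsFirstPillar toIsPurelyInseparable I₁
  extend_mul_torsion : ∀ i, R.extend I i * R.torsion I i = ⊥
  exists_frobTor : ∀ i, ∃ g : R.torsion I (i + 1) → R.torsion I i, Function.Bijective g ∧
    ∀ x, Ideal.Quotient.mk (R.extend I i) (g x : R.obj i) =
      frobProj toIsPurelyInseparable i (Ideal.Quotient.mk (R.extend I (i + 1)) (x : R.obj (i + 1)))

section Tilt

variable {p : ℕ} [Fact p.Prime] {R : RingTower.{u}} {S : RingTower.{v}}
  {I : Ideal (R.obj 0)} {J : Ideal (S.obj 0)}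

/-- The `i`-th small tilt: the inverse limit of
`⋯ → R_{i+2} / I R_{i+2} → R_{i+1} / I R_{i+1} → R_i / I R_i` along the Frobenius projections. -/
def smallTilt (h : R.IsPurelyInseparable p I) (i : ℕ) : Subring (∀ m, R.Red I (i + m)) where
  carrier := {x | ∀ m, frobProj h (i + m) (x (m + 1)) = x m}
  mul_mem' hx hy m := by simp [hx m, hy m]
  one_mem' m := by simp
  add_mem' hx hy m := by simp [hx m, hy m]
  zero_mem' m := by simp
  neg_mem' hx m := by simp [hx m]

theorem Hom.app_transition (α : Hom R S) (i : ℕ) :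
    (α.app i).comp (R.transition (Nat.zero_le i)) =
      (S.transition (Nat.zero_le i)).comp (α.app 0) := by
  induction i with
  | zero => rw [R.transition_self, S.transition_self]; rfl
  | succ n ih =>
    rw [R.transition_succ (Nat.zero_le n), S.transition_succ (Nat.zero_le n), RingHom.comp_assoc,
      ← ih, ← RingHom.comp_assoc, ← RingHom.comp_assoc, α.comm]

theorem Hom.map_extend_le (α : Hom R S) (hα : I.map (α.app 0) ≤ J) (i : ℕ) :
    (R.extend I i).map (α.app i) ≤ S.extend J i := by
  unfold extend
  rw [Ideal.map_map, α.app_transition, ← Ideal.map_map]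
  exact Ideal.map_mono hα

/-- The map `R_i / I R_i → S_i / J S_i` induced by a morphism of towers with `α_0(I) ⊆ J`. -/
def Hom.red (α : Hom R S) (hα : I.map (α.app 0) ≤ J) (i : ℕ) : R.Red I i →+* S.Red J i :=
  Ideal.quotientMap _ (α.app i) (Ideal.map_le_iff_le_comap.mp (α.map_extend_le hα i))

theorem Hom.red_redMap (α : Hom R S) (hα : I.map (α.app 0) ≤ J) (i : ℕ) (x : R.Red I i) :
    α.red hα (i + 1) (R.redMap I i x) = S.redMap J i (α.red hα i x) := by
  obtain ⟨x, rfl⟩ := Ideal.Quotient.mk_surjective x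
  simpa [red] using congrArg (Ideal.Quotient.mk _) (RingHom.congr_fun (α.comm i) x).symm

theorem Hom.red_frobProj (hR : R.IsPurelyInseparable p I) (hS : S.IsPurelyInseparable p J)
    (α : Hom R S) (hα : I.map (α.app 0) ≤ J) (i : ℕ) (x : R.Red I (i + 1)) :
    frobProj hS i (α.red hα (i + 1) x) = α.red hα i (frobProj hR i x) := by
  apply hS.redMap_injective i
  rw [redMap_frobProj, ← α.red_redMap, redMap_frobProj, map_pow]

/-- The tilt of a morphism of towers at level `i`: the ring homomorphism between the `i`-th small
tilts given by `R_{i+m} / I R_{i+m} → S_{i+m} / J S_{i+m}` in the `m`-th component. -/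
def Hom.tilt (hR : R.IsPurelyInseparable p I) (hS : S.IsPurelyInseparable p J)
    (α : Hom R S) (hα : I.map (α.app 0) ≤ J) (i : ℕ) : smallTilt hR i →+* smallTilt hS i where
  toFun x := ⟨fun m => α.red hα (i + m) (x.1 m), fun m =>
    (α.red_frobProj hR hS hα (i + m) (x.1 (m + 1))).trans (congrArg _ (x.2 m))⟩
  map_one' := Subtype.ext <| funext fun _ => map_one _
  map_mul' _ _ := Subtype.ext <| funext fun _ => map_mul _ _ _
  map_zero' := Subtype.ext <| funext fun _ => map_zero _
  map_add' _ _ := Subtype.ext <| funext fun _ => map_add _ _ _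

end Tilt

end RingTower

open TensorProduct

/-!
The proof reduces flatness of `α_i` and of its tilt to one and the same condition on the
reduction `R_i / I₀ R_i → S_i / J₀ S_i`.

*Flatness modulo one element.* Let `φ : R → S` be a ring homomorphism and `t ∈ R`, where `R` is
noetherian, where `S` either is noetherian with `t` in its Jacobson radical or is `t`-adically
complete, and where `t ^ 2 s = 0` implies `t s = 0` in `S`. Then `φ` is flat if and only if
`R / t → S / t` is flat and the image of `Ann_S t` in `S / t` lies in the ideal generated by the
image of `Ann_R t` (`RingHom.flat_iff_of_surjective_of_ker_eq_span_singleton`). The second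
condition says that `Tor₁ (R / t, S) = 0`. For the converse direction let `K_𝔞` be the kernel of
`S ⊗ 𝔞 → S`, for an ideal `𝔞` of `R`. The equational criterion for flatness modulo `t` shows that
`K_𝔞` is the image of `K_(𝔞 : t)` under multiplication by `t` (`Ideal.exists_lTensor_colonMul_eq`).
By noetherian induction this leaves the case `𝔞 = (𝔞 : t)`, in which `K_𝔞 = t K_𝔞`. Then `K_𝔞 = 0`,
by Nakayama's lemma or, if `S` is complete, because a finitely presented module over a complete
ring has no nonzero divisible sequences (`eq_zero_of_divisible_of_finitePresentation`).

*The tilt.* A generator `f₁` of the first pillar lifts to an element `g = (0, f₁, …)` of the small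
tilt `T`. The `m`-th projection of `T` has kernel `g ^ p ^ m T` (`IsTiltGenerator.pow_dvd_iff`), so
`T` is `g`-adically complete and `T / g = R_i / I₀ R_i`. It follows that `T` is noetherian if `R_i`
is, and the criterion applies to `T` and `g`. The image of `g` under the tilt of `α` plays the same
role for `S`, as `I₁` generates `J₁`.

*Torsion.* Let `I₀` be generated by `f₀`. The torsion of `R_j` embeds in `R_j / I₀ R_j`, and the
Frobenius projections map these images bijectively onto one another. The elements of `T` all of
whose components lie in these images are exactly those killed by `g`, equivalently by `g ^ 2`
(`IsPreperfectoid.mem_annihilatorImage_of_pow_two_mul_eq_zero`). Therefore `Ann_T g` and the torsion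
of `R_i` have the same image in `R_i / I₀ R_i`, and the two instances of the criterion have the same
right-hand side.
-/

/-! ### Power series in an element of an adically complete ring -/

theorem IsPrecomplete.exists_sum_pow_mul {A : Type*} [CommRing A] {t : A}
    (hA : IsPrecomplete (Ideal.span {t}) A) (w : ℕ → A) :
    ∃ L : A, ∀ n, t ^ n ∣ L - ∑ k ∈ Finset.range n, t ^ k * w k := by
  obtain ⟨L, hL⟩ := hA.prec (f := fun n => ∑ k ∈ Finset.range n, t ^ k * w k) (by
    intro m n hmn
    rw [SModEq.sub_mem, smul_eq_mul, Ideal.mul_top, Ideal.span_singleton_pow,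
      Ideal.mem_span_singleton, ← dvd_neg, neg_sub, ← Finset.sum_Ico_eq_sub _ hmn]
    exact Finset.dvd_sum fun k hk => (pow_dvd_pow t (Finset.mem_Ico.mp hk).1).mul_right _)
  refine ⟨L, fun n => ?_⟩
  have := hL n
  rwa [SModEq.sub_mem, smul_eq_mul, Ideal.mul_top, Ideal.span_singleton_pow,
    Ideal.mem_span_singleton, ← dvd_neg, neg_sub] at this

theorem IsHausdorff.eq_zero_of_forall_pow_dvd {A : Type*} [CommRing A] {t : A}
    (hA : IsHausdorff (Ideal.span {t}) A) {x : A} (h : ∀ n, t ^ n ∣ x) : x = 0 :=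
  hA.haus x fun n => by
    rw [SModEq.zero, smul_eq_mul, Ideal.mul_top, Ideal.span_singleton_pow,
      Ideal.mem_span_singleton]
    exact h n

/-- A finitely presented module over a `t`-adically complete ring has no nonzero `t`-divisible
sequences. Such a module need not be `t`-adically separated: divisibility of the single element
`z 0` by all powers of `t` would not suffice. -/
theorem eq_zero_of_divisible_of_finitePresentation {A M : Type*} [CommRing A] [AddCommGroup M]
    [Module A M] [Module.FinitePresentation A M] {t : A} (hA : IsAdicComplete (Ideal.span {t}) A)
    (z : ℕ → M) (hz : ∀ k, z k = t • z (k + 1)) : z 0 = 0 := by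
  obtain ⟨n, m, f, g, hf, hfg⟩ := Module.FinitePresentation.exists_fin' A M
  choose y hy using fun k => hf (z k)
  have h1 : ∀ k, ∃ w, g w = y k - t • y (k + 1) := fun k => (hfg _).mp (by
    rw [map_sub, map_smul, hy, hy, ← hz, sub_self])
  choose w hw using h1
  choose W hW using fun j => hA.toIsPrecomplete.exists_sum_pow_mul fun k => w k j
  have h2 : ∀ N, y 0 - g (∑ k ∈ Finset.range N, t ^ k • w k) = t ^ N • y N := by
    intro N
    induction N with
    | zero => simp
    | succ N ih =>
      rw [Finset.sum_range_succ, map_add, ← sub_sub, ih, map_smul, hw, smul_sub, smul_smul,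
        ← pow_succ, sub_sub_cancel]
  -- `W` is the sum of the series `∑ t ^ k • w k`, so `y 0 - g W` lies in every `t ^ N A ^ n`.
  have h3 : y 0 = g W := by
    rw [← sub_eq_zero]
    funext i
    refine hA.toIsHausdorff.eq_zero_of_forall_pow_dvd fun N => ?_
    choose c hc using fun j => hW j N
    have h4 : W = (∑ k ∈ Finset.range N, t ^ k • w k) + t ^ N • c := by
      funext j
      have := hc j
      simp only [Pi.add_apply, Finset.sum_apply, Pi.smul_apply, smul_eq_mul]
      linear_combination this
    rw [h4, map_add, ← sub_sub, h2, map_smul, ← smul_sub]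
    exact Dvd.intro _ rfl
  rw [← hy 0, h3]
  exact (hfg _).mpr ⟨W, rfl⟩

/-- A ring complete with respect to a principal ideal is noetherian if its quotient by that ideal
is. By Cohen's theorem only prime ideals have to be considered. -/
theorem IsNoetherianRing.of_isAdicComplete_span_singleton {A B : Type*} [CommRing A] [CommRing B]
    [IsNoetherianRing B] {t : A} (hA : IsAdicComplete (Ideal.span {t}) A) (π : A →+* B)
    (hπ : Function.Surjective π) (hker : RingHom.ker π = Ideal.span {t}) :
    IsNoetherianRing A := by
  refine IsNoetherianRing.of_prime fun P hP => ?_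
  obtain ⟨n, b, hb⟩ := Submodule.fg_iff_exists_fin_generating_family.mp
    (IsNoetherian.noetherian (P.map π))
  have hbm : ∀ i, ∃ a ∈ P, π a = b i := fun i =>
    (Ideal.mem_map_iff_of_surjective π hπ).mp (hb ▸ Submodule.subset_span ⟨i, rfl⟩)
  choose a haP hab using hbm
  have hle : Ideal.span (Set.range a) ≤ P := Ideal.span_le.mpr (by rintro _ ⟨i, rfl⟩; exact haP i)
  have hdec : ∀ x ∈ P, ∃ c : Fin n → A, ∃ y, x = ∑ i, c i * a i + t * y := by
    intro x hx
    have h1 : π x ∈ Submodule.span B (Set.range b) := hb ▸ Ideal.mem_map_of_mem π hx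
    obtain ⟨c, hc⟩ := (Submodule.mem_span_range_iff_exists_fun B).mp h1
    choose d hd using fun i => hπ (c i)
    have h2 : x - ∑ i, d i * a i ∈ RingHom.ker π := by
      rw [RingHom.mem_ker, map_sub, map_sum, ← hc, sub_eq_zero]
      simp [hd, hab]
    rw [hker, Ideal.mem_span_singleton] at h2
    obtain ⟨y, hy⟩ := h2
    exact ⟨d, y, by linear_combination hy⟩
  by_cases ht : t ∈ P
  · have : P = Ideal.span (Set.range a) ⊔ Ideal.span {t} := by
      refine le_antisymm (fun x hx => ?_) (sup_le hle (by simpa [Ideal.span_le] using ht))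
      obtain ⟨c, y, rfl⟩ := hdec x hx
      refine add_mem (Ideal.mem_sup_left (sum_mem fun i _ => Ideal.mul_mem_left _ _
        (Ideal.subset_span ⟨i, rfl⟩))) (Ideal.mem_sup_right ?_)
      exact Ideal.mul_mem_right _ _ (Ideal.mem_span_singleton_self t)
    rw [this]
    exact Submodule.FG.sup (Submodule.fg_span (Set.finite_range a))
      (Submodule.fg_span_singleton t)
  -- If `t ∉ P`, the remainder of an element of `P` is again in `P`, and the expansion iterates.
  · have hdec' : ∀ x : P, ∃ c : Fin n → A, ∃ y : P, (x : A) = ∑ i, c i * a i + t * y := by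
      intro x
      obtain ⟨c, y, hx⟩ := hdec x x.2
      refine ⟨c, ⟨y, ?_⟩, hx⟩
      have : t * y ∈ P := by
        rw [← sub_eq_iff_eq_add'.mpr hx]
        exact sub_mem x.2 (sum_mem fun i _ => Ideal.mul_mem_left _ _ (haP i))
      exact (hP.mem_or_mem this).resolve_left ht
    choose c r hcr using hdec'
    have : P = Ideal.span (Set.range a) := by
      refine le_antisymm (fun x hx => ?_) hle
      let z : ℕ → P := fun k => r^[k] ⟨x, hx⟩
      have hz : ∀ k, (z k : A) = ∑ i, c (z k) i * a i + t * z (k + 1) := fun k => by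
        have : z (k + 1) = r (z k) := Function.iterate_succ_apply' r k _
        rw [this]
        exact hcr _
      choose C hC using fun i => hA.toIsPrecomplete.exists_sum_pow_mul fun k => c (z k) i
      have hsum : ∀ N, x = ∑ i, (∑ k ∈ Finset.range N, t ^ k * c (z k) i) * a i
          + t ^ N * z N := by
        intro N
        induction N with
        | zero => simp [z]
        | succ N ih =>
          rw [ih, hz N]
          simp only [Finset.sum_range_succ, add_mul, Finset.sum_add_distrib, mul_add,
            Finset.mul_sum, pow_succ, mul_assoc, add_assoc]
      have hx' : x - ∑ i, C i * a i = 0 := by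
        refine hA.toIsHausdorff.eq_zero_of_forall_pow_dvd fun N => ?_
        choose d hd using fun i => hC i N
        have : x - ∑ i, C i * a i = t ^ N * (z N - ∑ i, d i * a i) := by
          have h5 : ∑ i, C i * a i = ∑ i, (∑ k ∈ Finset.range N, t ^ k * c (z k) i) * a i
              + t ^ N * ∑ i, d i * a i := by
            rw [Finset.mul_sum, ← Finset.sum_add_distrib]
            refine Finset.sum_congr rfl fun i _ => ?_
            linear_combination a i * hd i
          rw [h5]
          linear_combination hsum N
        exact this ▸ dvd_mul_right _ _
      rw [sub_eq_zero.mp hx']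
      exact sum_mem fun i _ => Ideal.mul_mem_left _ _ (Ideal.subset_span ⟨i, rfl⟩)
    rw [this]
    exact Submodule.fg_span (Set.finite_range a)

/-! ### Flatness modulo a principal ideal -/

section Flatness

variable {R S Rb Sb : Type*} [CommRing R] [CommRing S] [CommRing Rb] [CommRing Sb]
  [Algebra R S] [Algebra Rb Sb] {π : R →+* Rb} {ρ : S →+* Sb} {t : R}

/-- The annihilator of `t` in `S` is generated by the annihilator of `t` in `R`; equivalently,
`Tor₁ (R / t R, S)` vanishes. -/
def AnnihilatorGenerated (S : Type*) {R : Type*} [CommRing R] [CommRing S] [Algebra R S]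
    (t : R) : Prop :=
  ∀ s : S, t • s = 0 → s ∈ (Ideal.span {t}).annihilator.map (algebraMap R S)

theorem Module.Flat.annihilatorGenerated [Module.Flat R S] (t : R) :
    AnnihilatorGenerated S t := by
  intro s hs
  obtain ⟨k, a, y, hx, ha⟩ := Module.Flat.isTrivialRelation_of_sum_smul_eq_zero
    (R := R) (ι := Unit) (f := fun _ => t) (x := fun _ => s) (by simpa using hs)
  have hx' : s = _ := hx ()
  rw [hx']
  refine sum_mem fun j _ => ?_
  rw [Algebra.smul_def]
  refine Ideal.mul_mem_right _ _ (Ideal.mem_map_of_mem _ ?_)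
  rw [Submodule.mem_annihilator_span_singleton]
  have := ha j
  rw [Fintype.sum_unique] at this
  rw [smul_eq_mul, mul_comm, this]

/-- Flatness passes to the quotients by a principal ideal. -/
theorem Module.Flat.of_surjective_of_ker_eq_span_singleton [Module.Flat R S]
    (hπ : Function.Surjective π) (hρ : Function.Surjective ρ) (hπt : π t = 0)
    (hρker : RingHom.ker ρ = Ideal.span {algebraMap R S t})
    (comm : ∀ r, ρ (algebraMap R S r) = algebraMap Rb Sb (π r)) : Module.Flat Rb Sb := by
  refine Module.Flat.of_forall_isTrivialRelation fun {l} {f} {x} h => ?_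
  choose F hF using fun i => hπ (f i)
  choose X hX using fun i => hρ (x i)
  have h1 : ∑ i, F i • X i ∈ RingHom.ker ρ := by
    rw [RingHom.mem_ker, map_sum, ← h]
    exact Finset.sum_congr rfl fun i _ => by
      rw [Algebra.smul_def, map_mul, comm, hF, hX, Algebra.smul_def]
  rw [hρker, Ideal.mem_span_singleton] at h1
  obtain ⟨y, hy⟩ := h1
  -- The relation `∑ F i X i - t y = 0` in `S` is trivial; reduce the trivialisation modulo `t`.
  obtain ⟨k, a, z, hz, ha⟩ := Module.Flat.isTrivialRelation_of_sum_smul_eq_zero (R := R)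
    (ι := Option (Fin l)) (f := fun o => o.elim t F) (x := fun o => o.elim (-y) X) (by
      simp only [Fintype.sum_option, Option.elim_none, Option.elim_some]
      rw [hy, Algebra.smul_def, mul_neg, neg_add_cancel])
  refine ⟨k, fun i j => π (a (some i) j), fun j => ρ (z j), fun i => ?_, fun j => ?_⟩
  · have := congrArg ρ (hz (some i))
    simpa [hX, Algebra.smul_def, comm] using this
  · have := congrArg π (ha j)
    simpa [Fintype.sum_option, hF, hπt] using this

/-- A relation in `S` modulo `t` is trivial up to multiples of `t`, if `S` is flat modulo `t`. -/
theorem Module.Flat.exists_trivial_relation_modulo [Module.Flat Rb Sb]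
    (hπ : Function.Surjective π) (hρ : Function.Surjective ρ)
    (hπker : RingHom.ker π = Ideal.span {t})
    (hρker : RingHom.ker ρ = Ideal.span {algebraMap R S t})
    (comm : ∀ r, ρ (algebraMap R S r) = algebraMap Rb Sb (π r))
    {l : ℕ} (f : Fin l → R) (x : Fin l → S) (h : ∑ i, f i • x i = 0) :
    ∃ (k : ℕ) (c : Fin l → Fin k → R) (y : Fin k → S) (z : Fin l → S) (d : Fin k → R),
      (∀ i, x i = ∑ j, c i j • y j + t • z i) ∧ ∀ j, ∑ i, f i * c i j = t * d j := by
  obtain ⟨k, a, y, hx, ha⟩ := Module.Flat.isTrivialRelation_of_sum_smul_eq_zero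
    (R := Rb) (f := fun i => π (f i)) (x := fun i => ρ (x i)) (by
      simpa [Algebra.smul_def, comm] using congrArg ρ h)
  choose c hc using fun i j => hπ (a i j)
  choose Y hY using fun j => hρ (y j)
  have h1 : ∀ i, ∃ z, x i = ∑ j, c i j • Y j + t • z := fun i => by
    have : x i - ∑ j, c i j • Y j ∈ RingHom.ker ρ := by
      have hx' : ρ (x i) = _ := hx i
      rw [RingHom.mem_ker, map_sub, hx', map_sum, sub_eq_zero]
      simp [Algebra.smul_def, comm, hc, hY]
    rw [hρker, Ideal.mem_span_singleton] at this
    obtain ⟨z, hz⟩ := this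
    exact ⟨z, by rw [Algebra.smul_def t]; linear_combination hz⟩
  have h2 : ∀ j, ∃ d, ∑ i, f i * c i j = t * d := fun j => by
    rw [← dvd_def, ← Ideal.mem_span_singleton, ← hπker, RingHom.mem_ker, map_sum]
    simpa [hc] using ha j
  choose z hz using h1
  choose d hd using h2
  exact ⟨k, c, Y, z, d, hz, hd⟩

/-- The multiplication map `S ⊗ 𝔞 → S` of an ideal `𝔞` of `R`. -/
noncomputable def Ideal.tensorMul (S : Type*) {R : Type*} [CommRing R] [CommRing S] [Algebra R S]
    (𝔞 : Ideal R) : S ⊗[R] 𝔞 →ₗ[S] S :=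
  (Algebra.linearMap R S ∘ₗ 𝔞.subtype).liftBaseChange S

@[simp] theorem Ideal.tensorMul_tmul (𝔞 : Ideal R) (s : S) (a : 𝔞) :
    𝔞.tensorMul S (s ⊗ₜ a) = (a : R) • s := by
  simp [Ideal.tensorMul, Algebra.smul_def, mul_comm]

theorem Module.Flat.of_forall_tensorMul
    (h : ∀ (𝔞 : Ideal R) (z : S ⊗[R] 𝔞), 𝔞.tensorMul S z = 0 → z = 0) : Module.Flat R S := by
  refine Module.Flat.iff_lTensor_injective'.mpr fun 𝔞 => (injective_iff_map_eq_zero _).mpr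
    fun z hz => h 𝔞 z ?_
  have : (𝔞.tensorMul S).restrictScalars R =
      (TensorProduct.rid R S).toLinearMap ∘ₗ 𝔞.subtype.lTensor S := by
    ext; simp
  have h2 := LinearMap.congr_fun this z
  simpa [hz] using h2

/-- Multiplication by `t`, as a map from `𝔟 = (𝔞 : t)` to `𝔞`. -/
def Ideal.colonMul {𝔞 𝔟 : Ideal R} (h : ∀ x, x ∈ 𝔟 ↔ t * x ∈ 𝔞) : 𝔟 →ₗ[R] 𝔞 :=
  (LinearMap.lsmul R R t ∘ₗ 𝔟.subtype).codRestrict 𝔞 fun x => (h x).mp x.2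

@[simp] theorem Ideal.coe_colonMul {𝔞 𝔟 : Ideal R} (h : ∀ x, x ∈ 𝔟 ↔ t * x ∈ 𝔞) (x : 𝔟) :
    (Ideal.colonMul h x : R) = t * x := rfl

/-- The dévissage step of the flatness criterion: elements of the kernel of `S ⊗ 𝔞 → S`
are `t` times elements of the kernel of `S ⊗ (𝔞 : t) → S`. -/
theorem Ideal.exists_lTensor_colonMul_eq [Module.Flat Rb Sb]
    (hπ : Function.Surjective π) (hρ : Function.Surjective ρ)
    (hπker : RingHom.ker π = Ideal.span {t})
    (hρker : RingHom.ker ρ = Ideal.span {algebraMap R S t})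
    (comm : ∀ r, ρ (algebraMap R S r) = algebraMap Rb Sb (π r))
    (hann : AnnihilatorGenerated S t) {𝔞 𝔟 : Ideal R} (h : ∀ x, x ∈ 𝔟 ↔ t * x ∈ 𝔞)
    (z : S ⊗[R] 𝔞) (hz : 𝔞.tensorMul S z = 0) :
    ∃ w : S ⊗[R] 𝔟, 𝔟.tensorMul S w = 0 ∧ (Ideal.colonMul h).lTensor S w = z := by
  obtain ⟨l, x, f, rfl⟩ := TensorProduct.exists_sum_tmul_eq z
  obtain ⟨k, c, y, v, d, hx, hd⟩ := Module.Flat.exists_trivial_relation_modulo hπ hρ hπker hρker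
    comm (fun i => (f i : R)) x (by simpa using hz)
  have hd' : ∀ j, d j ∈ 𝔟 := fun j => by
    rw [h, ← hd]
    exact _root_.sum_mem fun i _ => Ideal.mul_mem_right _ _ (f i).2
  have hf' : ∀ i, (f i : R) ∈ 𝔟 := fun i => (h _).mpr (Ideal.mul_mem_left _ _ (f i).2)
  let w : S ⊗[R] 𝔟 := ∑ j, y j ⊗ₜ ⟨d j, hd' j⟩ + ∑ i, v i ⊗ₜ ⟨f i, hf' i⟩
  have hw : (Ideal.colonMul h).lTensor S w = ∑ i, x i ⊗ₜ f i := by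
    have h1 : ∀ j, Ideal.colonMul h ⟨d j, hd' j⟩ = ∑ i, c i j • f i := fun j => by
      ext
      simp [← hd j, mul_comm]
    have h2 : ∀ i, Ideal.colonMul h ⟨f i, hf' i⟩ = t • f i := fun i => by
      ext
      simp
    simp only [w, map_add, map_sum, LinearMap.lTensor_tmul, h1, h2, hx, add_tmul, sum_tmul,
      tmul_sum, smul_tmul, Finset.sum_add_distrib]
    rw [Finset.sum_comm]
  -- The image of `w` in `S` is killed by `t`, so it comes from the annihilator of `t` in `R`,
  -- which lies in `𝔟`.
  have hws : t • 𝔟.tensorMul S w = 0 := by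
    have : ((LinearMap.lsmul R S t) ∘ₗ (𝔟.tensorMul S).restrictScalars R) =
        (𝔞.tensorMul S).restrictScalars R ∘ₗ (Ideal.colonMul h).lTensor S := by
      ext; simp [smul_smul, mul_comm]
    have h2 := LinearMap.congr_fun this w
    simp only [LinearMap.comp_apply, LinearMap.lsmul_apply, LinearMap.restrictScalars_apply,
      hw] at h2
    rw [h2, hz]
  have key : ∀ s ∈ (Ideal.span {t}).annihilator.map (algebraMap R S), ∃ u : S ⊗[R] 𝔟,
      𝔟.tensorMul S u = s ∧ (Ideal.colonMul h).lTensor S u = 0 := by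
    intro s hs
    refine Submodule.span_induction ?_ ⟨0, by simp⟩ ?_ ?_ hs
    · rintro _ ⟨a, ha, rfl⟩
      have ha' : t * a = 0 := by
        rw [mul_comm]
        exact Submodule.mem_annihilator_span_singleton _ _ |>.mp ha
      refine ⟨1 ⊗ₜ ⟨a, (h a).mpr (by simp [ha'])⟩, by simp [Algebra.smul_def], ?_⟩
      have : Ideal.colonMul h ⟨a, (h a).mpr (by simp [ha'])⟩ = 0 := by
        ext
        simp [ha']
      rw [LinearMap.lTensor_tmul, this, tmul_zero]
    · rintro _ _ _ _ ⟨u, hu, hu'⟩ ⟨u₂, hu₂, hu₂'⟩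
      exact ⟨u + u₂, by simp [hu, hu₂], by simp [hu', hu₂']⟩
    · rintro b _ _ ⟨u, hu, hu'⟩
      refine ⟨b • u, by simp [hu], ?_⟩
      have := ((Ideal.colonMul h).baseChange S).map_smul b u
      rw [LinearMap.baseChange_eq_ltensor] at this
      rw [this, hu', smul_zero]
  obtain ⟨u, hu, hu'⟩ := key _ (hann _ hws)
  exact ⟨w - u, by simp [hu], by rw [map_sub, hu', hw, sub_zero]⟩

/-- The hypothesis on `S` under which the flatness criterion holds: either `S` is noetherian and
`t` lies in its Jacobson radical, or `S` is `t`-adically complete. -/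
def NoetherianOrComplete (S : Type*) [CommRing S] (t : S) : Prop :=
  (IsNoetherianRing S ∧ Ideal.span {t} ≤ Ideal.jacobson (⊥ : Ideal S)) ∨
    IsAdicComplete (Ideal.span {t}) S

/-- Under `NoetherianOrComplete`, a submodule `Z = t Z` of a finitely presented module vanishes. In
the complete case `Z` itself need not be finitely generated, so Nakayama's lemma is not enough. -/
theorem NoetherianOrComplete.eq_bot_of_divisible {t : S} (hS : NoetherianOrComplete S t)
    {M : Type*} [AddCommGroup M] [Module S M] [Module.FinitePresentation S M]
    (Z : Submodule S M) (hZ : ∀ z ∈ Z, ∃ w ∈ Z, z = t • w) : Z = ⊥ := by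
  rcases hS with ⟨hN, hJ⟩ | hS
  · refine Submodule.eq_bot_of_le_smul_of_le_jacobson_bot (Ideal.span {t}) Z
      (IsNoetherian.noetherian Z) (fun z hz => ?_) hJ
    obtain ⟨w, hw, rfl⟩ := hZ z hz
    exact Submodule.smul_mem_smul (Ideal.mem_span_singleton_self t) hw
  · refine (Submodule.eq_bot_iff Z).mpr fun z hz => ?_
    have hZ' : ∀ z : Z, ∃ w : Z, (z : M) = t • (w : M) := fun z => by
      obtain ⟨w, hw, h⟩ := hZ z z.2
      exact ⟨⟨w, hw⟩, h⟩
    choose r hr using hZ'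
    refine eq_zero_of_divisible_of_finitePresentation hS (fun k => (r^[k] ⟨z, hz⟩ : M)) fun k => ?_
    rw [Function.iterate_succ_apply']
    exact hr _

/-- The **flatness criterion**: over a noetherian ring `R`, flatness of `S` follows from flatness
modulo `t` together with the vanishing of `Tor₁ (R / t R, S)`. -/
theorem Module.Flat.of_flat_modulo_span_singleton [IsNoetherianRing R] [Module.Flat Rb Sb]
    (hS : NoetherianOrComplete S (algebraMap R S t))
    (hπ : Function.Surjective π) (hρ : Function.Surjective ρ)
    (hπker : RingHom.ker π = Ideal.span {t})
    (hρker : RingHom.ker ρ = Ideal.span {algebraMap R S t})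
    (comm : ∀ r, ρ (algebraMap R S r) = algebraMap Rb Sb (π r))
    (hann : AnnihilatorGenerated S t) : Module.Flat R S := by
  refine Module.Flat.of_forall_tensorMul fun 𝔞 => ?_
  induction 𝔞 using IsNoetherian.induction with
  | hgt 𝔞 ih =>
  let 𝔟 : Ideal R := 𝔞.comap (LinearMap.lsmul R R t)
  have hb : ∀ x, x ∈ 𝔟 ↔ t * x ∈ 𝔞 := fun x => Iff.rfl
  have hle : 𝔞 ≤ 𝔟 := fun x hx => Ideal.mul_mem_left _ _ hx
  have step := fun z hz =>
    Ideal.exists_lTensor_colonMul_eq hπ hρ hπker hρker comm hann hb z hz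
  rcases hle.lt_or_eq with hlt | heq
  · intro z hz
    obtain ⟨w, hw, rfl⟩ := step z hz
    rw [ih 𝔟 hlt w hw, map_zero]
  -- If `(𝔞 : t) = 𝔞`, then the kernel of `S ⊗ 𝔞 → S` is divisible by `t`.
  · have ha : ∀ x, x ∈ 𝔞 ↔ t * x ∈ 𝔞 := fun x => by rw [← hb, ← heq]
    have := Module.finitePresentation_of_finite R 𝔞
    have hbot := hS.eq_bot_of_divisible (LinearMap.ker (Ideal.tensorMul S 𝔞)) fun z hz => by
      obtain ⟨w, hw, rfl⟩ :=
        Ideal.exists_lTensor_colonMul_eq hπ hρ hπker hρker comm hann ha z hz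
      refine ⟨w, hw, ?_⟩
      have h1 : Ideal.colonMul ha = t • LinearMap.id := by
        ext
        simp
      rw [h1, LinearMap.lTensor_smul, LinearMap.lTensor_id, algebraMap_smul]
      rfl
    intro z hz
    rwa [← LinearMap.mem_ker, hbot, Submodule.mem_bot] at hz

end Flatness

/-- The image in `B` of the annihilator of `t` in `A`. -/
def annihilatorImage {A B : Type*} [CommRing A] [CommRing B] (π : A →+* B) (t : A) : Ideal B :=
  (Ideal.span {t}).annihilator.map π

theorem mem_annihilatorImage {A B : Type*} [CommRing A] [CommRing B] {π : A →+* B}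
    (hπ : Function.Surjective π) {t : A} {b : B} :
    b ∈ annihilatorImage π t ↔ ∃ a, t * a = 0 ∧ π a = b := by
  simp [annihilatorImage, Ideal.mem_map_iff_of_surjective π hπ, mul_comm]

/-- Flatness of `φ : R → S` expressed modulo `t`: given bounded `t`-torsion in `S`, it only
depends on the reduction `φb` and on the images of the annihilators of `t`. -/
theorem RingHom.flat_iff_of_surjective_of_ker_eq_span_singleton
    {R S Rb Sb : Type*} [CommRing R] [CommRing S] [CommRing Rb] [CommRing Sb]
    [IsNoetherianRing R] (φ : R →+* S) (φb : Rb →+* Sb) (π : R →+* Rb) (ρ : S →+* Sb) (t : R)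
    (hπ : Function.Surjective π) (hρ : Function.Surjective ρ)
    (hπker : RingHom.ker π = Ideal.span {t}) (hρker : RingHom.ker ρ = Ideal.span {φ t})
    (comm : ∀ r, ρ (φ r) = φb (π r)) (hS : NoetherianOrComplete S (φ t))
    (htor : ∀ s, φ t ^ 2 * s = 0 → φ t * s = 0) :
    φ.Flat ↔ φb.Flat ∧ annihilatorImage ρ (φ t) ≤ (annihilatorImage π t).map φb := by
  algebraize [φ, φb]
  have hcomp : ρ.comp φ = φb.comp π := RingHom.ext comm
  have hmap : (annihilatorImage π t).map φb = ((Ideal.span {t}).annihilator.map φ).map ρ := by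
    rw [annihilatorImage, Ideal.map_map, Ideal.map_map, hcomp]
  constructor
  · intro h
    have h : Module.Flat R S := h
    refine ⟨Module.Flat.of_surjective_of_ker_eq_span_singleton hπ hρ (t := t) ?_ hρker comm, ?_⟩
    · rw [← RingHom.mem_ker, hπker]
      exact Ideal.mem_span_singleton_self t
    · rw [hmap]
      refine Ideal.map_mono fun s hs => Module.Flat.annihilatorGenerated (S := S) t s ?_
      rw [Submodule.mem_annihilator_span_singleton, smul_eq_mul] at hs
      rw [Algebra.smul_def, mul_comm]
      exact hs
  · rintro ⟨h, hle⟩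
    have h : Module.Flat Rb Sb := h
    refine Module.Flat.of_flat_modulo_span_singleton hS hπ hρ hπker hρker comm fun s hs => ?_
    have hs' : φ t * s = 0 := by rwa [Algebra.smul_def] at hs
    have h1 : ρ s ∈ ((Ideal.span {t}).annihilator.map φ).map ρ :=
      hmap ▸ hle ((mem_annihilatorImage hρ).mpr ⟨s, hs', rfl⟩)
    obtain ⟨s', hs'', hss⟩ := (Ideal.mem_map_iff_of_surjective ρ hρ).mp h1
    have h2 : s - s' ∈ RingHom.ker ρ := by rw [RingHom.mem_ker, map_sub, hss, sub_self]
    rw [hρker, Ideal.mem_span_singleton] at h2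
    obtain ⟨y, hy⟩ := h2
    have h3 : φ t * s' = 0 := by
      have : Ideal.map φ (Ideal.span {t}).annihilator ≤ (Ideal.span {φ t}).annihilator := by
        refine Ideal.map_le_iff_le_comap.mpr fun a ha => ?_
        rw [Submodule.mem_annihilator_span_singleton, smul_eq_mul] at ha
        rw [Ideal.mem_comap, Submodule.mem_annihilator_span_singleton, smul_eq_mul, ← map_mul, ha,
          map_zero]
      have := Submodule.mem_annihilator_span_singleton _ _ |>.mp (this hs'')
      rwa [smul_eq_mul, mul_comm] at this
    -- Bounded torsion gives `t S ∩ Ann t = 0`.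
    have h4 : φ t * y = 0 := htor y (by linear_combination hs' - h3 - φ t * hy)
    rw [← sub_add_cancel s s', hy, h4, zero_add]
    exact hs''

/-! ### The small tilt and its adic topology -/

/-- In an inverse system of surjections indexed by `ℕ`, each projection of the limit is
surjective. -/
theorem exists_compatible_seq_of_surjective {E : ℕ → Type*} (F : ∀ n, E (n + 1) → E n)
    (hF : ∀ n, Function.Surjective (F n)) (m : ℕ) (y : E m) :
    ∃ x : ∀ n, E n, (∀ n, F n (x (n + 1)) = x n) ∧ x m = y := by
  induction m generalizing E with
  | zero =>
    choose s hs using hF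
    exact ⟨fun n => Nat.rec (motive := E) y (fun k z => s k z) n, fun n => hs n _, rfl⟩
  | succ m ih =>
    obtain ⟨x, hx, hxm⟩ := ih (E := fun n => E (n + 1)) (fun n => F (n + 1))
      (fun n => hF (n + 1)) y
    refine ⟨fun n => Nat.casesOn (motive := E) n (F 0 (x 0)) x, fun n => ?_, hxm⟩
    cases n with
    | zero => rfl
    | succ n => exact hx n

namespace RingTower

variable {p : ℕ} [Fact p.Prime] {R : RingTower.{u}} {I : Ideal (R.obj 0)}
  {h : R.IsPurelyInseparable p I} {i : ℕ}

/-- The projection of the small tilt to `R_{i+m} / I R_{i+m}`. -/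
def smallTiltEval (h : R.IsPurelyInseparable p I) (i m : ℕ) :
    smallTilt h i →+* R.Red I (i + m) :=
  (Pi.evalRingHom _ m).comp (smallTilt h i).subtype

theorem frobProj_smallTiltEval (m : ℕ) (x : smallTilt h i) :
    frobProj h (i + m) (smallTiltEval h i (m + 1) x) = smallTiltEval h i m x :=
  x.2 m

theorem smallTilt_ext {x y : smallTilt h i}
    (hxy : ∀ m, smallTiltEval h i m x = smallTiltEval h i m y) : x = y :=
  Subtype.ext (funext hxy)

theorem smallTiltEval_surjective (hF : ∀ i, Function.Surjective (frobProj h i)) (m : ℕ) :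
    Function.Surjective (smallTiltEval h i m) := fun y => by
  obtain ⟨x, hx, hxm⟩ := exists_compatible_seq_of_surjective (E := fun m => R.Red I (i + m))
    (fun m => frobProj h (i + m)) (fun m => hF _) m y
  exact ⟨⟨x, hx⟩, hxm⟩

theorem smallTiltEval_eq_zero_of_le {x : smallTilt h i} {m n : ℕ} (hmn : m ≤ n)
    (hx : smallTiltEval h i n x = 0) : smallTiltEval h i m x = 0 := by
  induction n, hmn using Nat.le_induction with
  | base => exact hx
  | succ n _ ih =>
    refine ih ?_
    rw [← frobProj_smallTiltEval, hx, map_zero]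

/-- An element `g` of the small tilt with vanishing zeroth component whose first component is the
class of `f₁`. If `f₁` generates the first pillar, then `g` generates the kernel of the zeroth
projection (`IsTiltGenerator.ker_eval_zero`). -/
structure IsTiltGenerator (h : R.IsPurelyInseparable p I) (i : ℕ) (f₁ : R.obj 1)
    (g : smallTilt h i) : Prop where
  eval_zero : smallTiltEval h i 0 g = 0
  eval_one : smallTiltEval h i 1 g =
    Ideal.Quotient.mk _ (R.transition (Nat.le_add_left 1 i) f₁)

namespace IsTiltGenerator

variable {f₁ : R.obj 1} {g : smallTilt h i}

theorem eval_pow_eq_zero (hg : IsTiltGenerator h i f₁ g) (m : ℕ) :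
    smallTiltEval h i m g ^ p ^ m = 0 := by
  induction m with
  | zero => simpa using hg.eval_zero
  | succ m ih =>
    rw [pow_succ', pow_mul]
    have := redMap_frobProj h (i + m) (smallTiltEval h i (m + 1) g)
    rw [frobProj_smallTiltEval] at this
    rw [← map_pow] at ih
    exact (congrArg (· ^ p ^ m) this).symm.trans (by
      simp only [← map_pow]; rw [ih, map_zero])

theorem eval_succ_pow (hg : IsTiltGenerator h i f₁ g) (m : ℕ) :
    smallTiltEval h i (m + 1) g ^ p ^ m =
      Ideal.Quotient.mk _ (R.transition (Nat.le_add_left 1 (i + m)) f₁) := by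
  induction m with
  | zero => simpa using hg.eval_one
  | succ m ih =>
    rw [pow_succ', pow_mul]
    have := redMap_frobProj h (i + (m + 1)) (smallTiltEval h i (m + 1 + 1) g)
    rw [frobProj_smallTiltEval] at this
    refine (congrArg (· ^ p ^ m) this).symm.trans ?_
    rw [← map_pow, ih]
    refine (redMap_mk R I _ _).trans ?_
    exact congrArg _ (RingHom.congr_fun (R.transition_succ (Nat.le_add_left 1 _)) f₁).symm

theorem ker_frobProj {I₁ : Ideal (R.obj 1)} (hI₁ : IsFirstPillar h I₁) (hf₁ : I₁ = Ideal.span {f₁})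
    (hg : IsTiltGenerator h i f₁ g) (m : ℕ) : RingHom.ker (frobProj h (i + m)) =
      Ideal.span {smallTiltEval h i (m + 1) g ^ p ^ m} := by
  rw [hI₁.ker_eq, hg.eval_succ_pow, hf₁, Ideal.map_span, Ideal.map_span, Set.image_singleton,
    Set.image_singleton]
  rfl

theorem exists_sub_eval_succ_eq_zero {I₁ : Ideal (R.obj 1)} (hI₁ : IsFirstPillar h I₁)
    (hf₁ : I₁ = Ideal.span {f₁}) (hF : ∀ i, Function.Surjective (frobProj h i))
    (hg : IsTiltGenerator h i f₁ g) (m : ℕ) (x : smallTilt h i)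
    (hx : smallTiltEval h i m x = 0) :
    ∃ a, smallTiltEval h i (m + 1) (x - g ^ p ^ m * a) = 0 := by
  have h1 : smallTiltEval h i (m + 1) x ∈ RingHom.ker (frobProj h (i + m)) := by
    rw [RingHom.mem_ker, frobProj_smallTiltEval, hx]
  rw [hg.ker_frobProj hI₁ hf₁] at h1
  obtain ⟨y, hy⟩ := Ideal.mem_span_singleton.mp h1
  obtain ⟨a, rfl⟩ := smallTiltEval_surjective hF (m + 1) y
  refine ⟨a, ?_⟩
  rw [map_sub, map_mul, map_pow]
  exact sub_eq_zero.mpr hy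

theorem eval_pow_of_le (hg : IsTiltGenerator h i f₁ g) {m n : ℕ} (hn : p ^ m ≤ n) :
    smallTiltEval h i m (g ^ n) = 0 := by
  rw [map_pow]
  exact pow_eq_zero_of_le hn (hg.eval_pow_eq_zero m)

/-- The kernel of the `m`-th projection is generated by `g ^ p ^ m`. The quotient by the generator
is built as an infinite sum that converges in each component. -/
theorem pow_dvd_iff {I₁ : Ideal (R.obj 1)} (hI₁ : IsFirstPillar h I₁)
    (hf₁ : I₁ = Ideal.span {f₁}) (hF : ∀ i, Function.Surjective (frobProj h i))
    (hg : IsTiltGenerator h i f₁ g) (m : ℕ) (x : smallTilt h i) :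
    g ^ p ^ m ∣ x ↔ smallTiltEval h i m x = 0 := by
  constructor
  · rintro ⟨y, rfl⟩
    rw [map_mul, hg.eval_pow_of_le le_rfl, zero_mul]
  intro hx
  have hstep : ∀ n y, ∃ a, smallTiltEval h i n y = 0 →
      smallTiltEval h i (n + 1) (y - g ^ p ^ n * a) = 0 := fun n y => by
    by_cases hy : smallTiltEval h i n y = 0
    · obtain ⟨a, ha⟩ := hg.exists_sub_eval_succ_eq_zero hI₁ hf₁ hF n y hy
      exact ⟨a, fun _ => ha⟩
    · exact ⟨0, fun hy' => absurd hy' hy⟩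
  choose a ha using hstep
  let r : ℕ → smallTilt h i := fun k =>
    Nat.rec x (fun k y => y - g ^ p ^ (m + k) * a (m + k) y) k
  have hr : ∀ k, r (k + 1) = r k - g ^ p ^ (m + k) * a (m + k) (r k) := fun k => rfl
  have hr0 : ∀ k, smallTiltEval h i (m + k) (r k) = 0 := fun k => by
    induction k with
    | zero => exact hx
    | succ k ih => exact ha _ _ ih
  have hp2 : 2 ≤ p := (Fact.out : p.Prime).two_le
  have hle : ∀ k, p ^ m ≤ p ^ (m + k) := fun k => Nat.pow_le_pow_right (by omega) (by omega)
  let w : ℕ → smallTilt h i := fun k => g ^ (p ^ (m + k) - p ^ m) * a (m + k) (r k)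
  have hw : ∀ k, smallTiltEval h i k (w (k + 1)) = 0 := fun k => by
    have h1 : p ^ k ≤ p ^ (m + (k + 1)) - p ^ m := by
      have h2 : p ^ k ≤ p ^ (m + k) := Nat.pow_le_pow_right (by omega) (by omega)
      have h3 : p ^ (m + (k + 1)) = p ^ (m + k) * p := by rw [← add_assoc, pow_succ]
      have h4 := hle k
      have h5 : p ^ (m + k) * 2 ≤ p ^ (m + k) * p := Nat.mul_le_mul_left _ hp2
      omega
    rw [map_mul, hg.eval_pow_of_le h1, zero_mul]
  let L : smallTilt h i :=
    ⟨fun n => smallTiltEval h i n (∑ k ∈ Finset.range (n + 1), w k), fun n => by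
      rw [frobProj_smallTiltEval, Finset.sum_range_succ, map_add, hw, add_zero]⟩
  have hL : ∀ n, smallTiltEval h i n L = smallTiltEval h i n (∑ k ∈ Finset.range (n + 1), w k) :=
    fun n => rfl
  have hsum : ∀ n, x - g ^ p ^ m * ∑ k ∈ Finset.range n, w k = r n := fun n => by
    induction n with
    | zero => simp [r]
    | succ n ih =>
      have h1 : g ^ p ^ m * w n = g ^ p ^ (m + n) * a (m + n) (r n) := by
        simp only [w]
        rw [← mul_assoc, ← pow_add, Nat.add_sub_cancel' (hle n)]
      rw [Finset.sum_range_succ, mul_add, ← sub_sub, ih, h1, hr]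
  refine ⟨L, sub_eq_zero.mp (smallTilt_ext fun n => ?_)⟩
  rw [map_sub, map_mul, hL, ← map_mul, ← map_sub, hsum, map_zero]
  exact smallTiltEval_eq_zero_of_le (by omega) (hr0 (n + 1))

theorem isAdicComplete {I₁ : Ideal (R.obj 1)} (hI₁ : IsFirstPillar h I₁)
    (hf₁ : I₁ = Ideal.span {f₁}) (hF : ∀ i, Function.Surjective (frobProj h i))
    (hg : IsTiltGenerator h i f₁ g) : IsAdicComplete (Ideal.span {g}) (smallTilt h i) where
  haus' x hx := smallTilt_ext fun m => by
    have := hx (p ^ m)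
    rw [SModEq.zero, smul_eq_mul, Ideal.mul_top, Ideal.span_singleton_pow,
      Ideal.mem_span_singleton, hg.pow_dvd_iff hI₁ hf₁ hF] at this
    rw [this, map_zero]
  prec' f hf := by
    have hf' : ∀ {m n}, m ≤ n → g ^ m ∣ f m - f n := fun hmn => by
      have := hf hmn
      rwa [SModEq.sub_mem, smul_eq_mul, Ideal.mul_top, Ideal.span_singleton_pow,
        Ideal.mem_span_singleton] at this
    have hp1 : 1 < p := (Fact.out : p.Prime).one_lt
    have hL : ∀ m, frobProj h (i + m) (smallTiltEval h i (m + 1) (f (p ^ (m + 1)))) =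
        smallTiltEval h i m (f (p ^ m)) := fun m => by
      have := (hg.pow_dvd_iff hI₁ hf₁ hF m _).mp
        (hf' (Nat.pow_le_pow_right hp1.le (Nat.le_add_right m 1)))
      rw [map_sub, sub_eq_zero] at this
      rw [frobProj_smallTiltEval, this]
    let L : smallTilt h i := ⟨fun m => smallTiltEval h i m (f (p ^ m)), hL⟩
    refine ⟨L, fun n => ?_⟩
    rw [SModEq.sub_mem, smul_eq_mul, Ideal.mul_top, Ideal.span_singleton_pow,
      Ideal.mem_span_singleton, ← sub_add_sub_cancel _ (f (p ^ n)) _]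
    have hn : n ≤ p ^ n := (Nat.lt_pow_self hp1).le
    refine dvd_add (hf' hn) ((pow_dvd_pow g hn).trans ((hg.pow_dvd_iff hI₁ hf₁ hF n _).mpr ?_))
    rw [map_sub]
    exact sub_self _

theorem ker_eval_zero {I₁ : Ideal (R.obj 1)} (hI₁ : IsFirstPillar h I₁)
    (hf₁ : I₁ = Ideal.span {f₁}) (hF : ∀ i, Function.Surjective (frobProj h i))
    (hg : IsTiltGenerator h i f₁ g) :
    RingHom.ker (smallTiltEval h i 0) = Ideal.span {g} := by
  ext x
  rw [RingHom.mem_ker, ← hg.pow_dvd_iff hI₁ hf₁ hF, pow_zero, pow_one, Ideal.mem_span_singleton]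

end IsTiltGenerator

theorem exists_isTiltGenerator {f₁ : R.obj 1} {I₁ : Ideal (R.obj 1)} (hI₁ : IsFirstPillar h I₁)
    (hf₁ : I₁ = Ideal.span {f₁}) (hF : ∀ i, Function.Surjective (frobProj h i)) (i : ℕ) :
    ∃ g, IsTiltGenerator h i f₁ g := by
  obtain ⟨g, hg⟩ := smallTiltEval_surjective (h := h) (i := i) hF 1
    (Ideal.Quotient.mk _ (R.transition (Nat.le_add_left 1 i) f₁))
  refine ⟨g, ?_, hg⟩
  rw [← frobProj_smallTiltEval, hg]
  refine RingHom.mem_ker.mp ?_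
  rw [hI₁.ker_eq, hf₁]
  exact Ideal.mem_map_of_mem _ (Ideal.mem_map_of_mem _ (Ideal.mem_span_singleton_self _))

end RingTower

/-! ### Torsion in the small tilt -/

/-- If `f₀` and `f₁ ^ p` generate the same ideal and `G ^ q` lifts `f₁` modulo `f₀`, then an
element `x` killed by `G ^ 2` modulo `f₀` is, up to a unit modulo `f₀` and a multiple of
`G ^ (q * p - 2)`, killed by `f₀`. No completeness is needed: the factor `e` with `G ^ q = f₁ * e`
is a unit only modulo `f₀`, and `x` gets multiplied by powers of it. -/
theorem exists_mul_eq_add_of_pow_two_mul_eq {A : Type*} [CommRing A] {f₀ f₁ v w G b x y : A}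
    {p q : ℕ} (hp : 2 ≤ p) (hq : 0 < q) (hv : f₀ = v * f₁ ^ p) (hw : f₁ ^ p = w * f₀)
    (hG : G ^ q = f₁ + f₀ * b) (hx : G ^ 2 * x = f₀ * y) :
    ∃ u z c, IsUnit (Ideal.Quotient.mk (Ideal.span {f₀}) u) ∧ f₀ * z = 0 ∧
      u * x = z + G ^ (q * p - 2) * c := by
  obtain ⟨k, rfl⟩ := Nat.exists_eq_add_of_le hp
  obtain ⟨N, hN⟩ := Nat.exists_eq_add_of_le (show 2 ≤ q * (2 + k) by nlinarith)
  let e := 1 + f₁ * (v * f₁ ^ k * b)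
  have he : G ^ q = f₁ * e := by
    rw [hG, hv]
    ring
  have heN : f₀ * e ^ (2 + k) = v * (G ^ 2 * G ^ N) := by
    rw [← pow_add, ← hN, pow_mul, he, mul_pow, hv]
    ring
  have hunit : IsUnit (Ideal.Quotient.mk (Ideal.span {f₀}) e) := by
    have hnil : IsNilpotent (Ideal.Quotient.mk (Ideal.span {f₀}) (f₁ * (v * f₁ ^ k * b))) := by
      refine ⟨2 + k, ?_⟩
      rw [← map_pow, mul_pow, hw, Ideal.Quotient.eq_zero_iff_mem, Ideal.mem_span_singleton]
      exact ⟨w * (v * f₁ ^ k * b) ^ (2 + k), by ring⟩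
    rw [map_add, map_one]
    exact hnil.isUnit_one_add
  have hX : G ^ 2 * (e ^ (2 + k) * x - v * y * G ^ N) = 0 := by
    linear_combination e ^ (2 + k) * hx + y * heN
  refine ⟨e ^ (2 + k) * e ^ (2 + k), e ^ (2 + k) * (e ^ (2 + k) * x - v * y * G ^ N),
    e ^ (2 + k) * v * y, ?_, ?_, ?_⟩
  · rw [map_mul, map_pow]
    exact (hunit.pow _).mul (hunit.pow _)
  · linear_combination (e ^ (2 + k) * x - v * y * G ^ N) * heN + v * G ^ N * hX
  · rw [hN, Nat.add_sub_cancel_left]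
    ring

namespace RingTower

variable {p : ℕ} [Fact p.Prime] {R : RingTower.{u}} {I : Ideal (R.obj 0)} {f₀ : R.obj 0}

theorem extend_eq_span_singleton (hf₀ : I = Ideal.span {f₀}) (j : ℕ) :
    R.extend I j = Ideal.span {R.transition (Nat.zero_le j) f₀} := by
  rw [extend, hf₀, Ideal.map_span, Set.image_singleton]

theorem IsFirstPillar.map_transition_pow {h : R.IsPurelyInseparable p I} {I₁ : Ideal (R.obj 1)}
    (hI₁ : IsFirstPillar h I₁) (j : ℕ) :
    I₁.map (R.transition (Nat.le_add_left 1 j)) ^ p = R.extend I (j + 1) := by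
  induction j with
  | zero =>
    refine Eq.trans ?_ hI₁.pow_eq
    have : R.transition (Nat.le_add_left 1 0) = RingHom.id _ := R.transition_self 1
    rw [this, Ideal.map_id]
  | succ j ih =>
    rw [extend_succ, ← ih, Ideal.map_pow, Ideal.map_map, ← transition_succ]

namespace IsPreperfectoid

variable (hR : R.IsPreperfectoid p I) (hf₀ : I = Ideal.span {f₀})

include hR hf₀

theorem mem_torsion_iff (j : ℕ) (x : R.obj j) :
    x ∈ R.torsion I j ↔ R.transition (Nat.zero_le j) f₀ * x = 0 := by
  constructor
  · intro hx
    have := Ideal.mul_mem_mul (show R.transition (Nat.zero_le j) f₀ ∈ R.extend I j by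
      rw [extend_eq_span_singleton hf₀]; exact Ideal.mem_span_singleton_self _) hx
    rwa [hR.extend_mul_torsion, Ideal.mem_bot] at this
  · intro hx a ha
    rw [hf₀, Ideal.mem_span_singleton] at ha
    obtain ⟨c, rfl⟩ := ha
    exact ⟨1, one_pos, by rw [pow_one, map_mul, mul_right_comm, hx, zero_mul]⟩

theorem mul_eq_zero_of_pow_two_mul_eq_zero (j : ℕ) (x : R.obj j)
    (hx : R.transition (Nat.zero_le j) f₀ ^ 2 * x = 0) :
    R.transition (Nat.zero_le j) f₀ * x = 0 := by
  rw [← hR.mem_torsion_iff hf₀]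
  intro a ha
  rw [hf₀, Ideal.mem_span_singleton] at ha
  obtain ⟨c, rfl⟩ := ha
  exact ⟨2, two_pos, by rw [map_mul, mul_pow, mul_right_comm, hx, zero_mul]⟩

theorem mem_annihilatorImage_iff (j : ℕ) (y : R.Red I j) :
    y ∈ annihilatorImage (Ideal.Quotient.mk (R.extend I j)) (R.transition (Nat.zero_le j) f₀) ↔
      ∃ x ∈ R.torsion I j, Ideal.Quotient.mk _ x = y := by
  rw [mem_annihilatorImage Ideal.Quotient.mk_surjective]
  simp only [hR.mem_torsion_iff hf₀]

/-- Torsion meets `I R_j` trivially, so it embeds in `R_j / I R_j`. -/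
theorem eq_zero_of_mem_torsion {j : ℕ} {x : R.obj j} (hx : x ∈ R.torsion I j)
    (hx0 : Ideal.Quotient.mk (R.extend I j) x = 0) : x = 0 := by
  rw [Ideal.Quotient.eq_zero_iff_mem, extend_eq_span_singleton hf₀,
    Ideal.mem_span_singleton] at hx0
  obtain ⟨y, rfl⟩ := hx0
  refine hR.mul_eq_zero_of_pow_two_mul_eq_zero hf₀ j y ?_
  rw [pow_two, mul_assoc]
  exact (hR.mem_torsion_iff hf₀ j _).mp hx

theorem frobProj_mem_annihilatorImage {j : ℕ} {y : R.Red I (j + 1)}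
    (hy : y ∈ annihilatorImage (Ideal.Quotient.mk (R.extend I (j + 1)))
      (R.transition (Nat.zero_le (j + 1)) f₀)) :
    frobProj hR.toIsPurelyInseparable j y ∈
      annihilatorImage (Ideal.Quotient.mk (R.extend I j)) (R.transition (Nat.zero_le j) f₀) := by
  rw [hR.mem_annihilatorImage_iff hf₀] at hy ⊢
  obtain ⟨x, hx, rfl⟩ := hy
  obtain ⟨g, -, hg⟩ := hR.exists_frobTor j
  exact ⟨g ⟨x, hx⟩, (g ⟨x, hx⟩).2, hg ⟨x, hx⟩⟩

theorem exists_mem_annihilatorImage_frobProj_eq {j : ℕ} {y : R.Red I j}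
    (hy : y ∈ annihilatorImage (Ideal.Quotient.mk (R.extend I j))
      (R.transition (Nat.zero_le j) f₀)) :
    ∃ z ∈ annihilatorImage (Ideal.Quotient.mk (R.extend I (j + 1)))
      (R.transition (Nat.zero_le (j + 1)) f₀), frobProj hR.toIsPurelyInseparable j z = y := by
  rw [hR.mem_annihilatorImage_iff hf₀] at hy
  obtain ⟨x, hx, rfl⟩ := hy
  obtain ⟨g, hgb, hg⟩ := hR.exists_frobTor j
  obtain ⟨z, hz⟩ := hgb.2 ⟨x, hx⟩
  refine ⟨_, (hR.mem_annihilatorImage_iff hf₀ _ _).mpr ⟨z, z.2, rfl⟩, ?_⟩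
  rw [← hg, hz]

theorem eq_zero_of_mem_annihilatorImage {j : ℕ} {y : R.Red I (j + 1)}
    (hy : y ∈ annihilatorImage (Ideal.Quotient.mk (R.extend I (j + 1)))
      (R.transition (Nat.zero_le (j + 1)) f₀))
    (hy0 : frobProj hR.toIsPurelyInseparable j y = 0) : y = 0 := by
  rw [hR.mem_annihilatorImage_iff hf₀] at hy
  obtain ⟨x, hx, rfl⟩ := hy
  obtain ⟨g, hgb, hg⟩ := hR.exists_frobTor j
  -- The bijection `g` is not assumed additive, but compatibility forces `g 0 = 0`.
  have h1 : ∀ x : R.torsion I (j + 1), frobProj hR.toIsPurelyInseparable j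
      (Ideal.Quotient.mk (R.extend I (j + 1)) (x : R.obj (j + 1))) = 0 → g x = 0 := fun x hx =>
    Subtype.ext (hR.eq_zero_of_mem_torsion hf₀ (g x).2 (by rw [hg, hx]))
  have h2 : g ⟨x, hx⟩ = g 0 := by
    rw [h1 ⟨x, hx⟩ hy0, h1 0 (by simp)]
  have h3 : x = 0 := congrArg Subtype.val (hgb.1 h2)
  rw [h3, map_zero]

variable {i : ℕ} {I₁ : Ideal (R.obj 1)} {f₁ : R.obj 1}
  {g : smallTilt hR.toIsPurelyInseparable i}

theorem eq_zero_of_forall_mem_annihilatorImage {x : smallTilt hR.toIsPurelyInseparable i}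
    (hx : ∀ m, smallTiltEval hR.toIsPurelyInseparable i m x ∈
      annihilatorImage (Ideal.Quotient.mk (R.extend I (i + m)))
        (R.transition (Nat.zero_le (i + m)) f₀))
    (hx0 : smallTiltEval hR.toIsPurelyInseparable i 0 x = 0) : x = 0 := by
  refine smallTilt_ext fun m => ?_
  rw [map_zero]
  induction m with
  | zero => exact hx0
  | succ m ih =>
    exact hR.eq_zero_of_mem_annihilatorImage hf₀ (hx (m + 1))
      ((frobProj_smallTiltEval m x).trans ih)

theorem mul_eq_zero_of_forall_mem_annihilatorImage
    (hg : IsTiltGenerator hR.toIsPurelyInseparable i f₁ g)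
    {x : smallTilt hR.toIsPurelyInseparable i}
    (hx : ∀ m, smallTiltEval hR.toIsPurelyInseparable i m x ∈
      annihilatorImage (Ideal.Quotient.mk (R.extend I (i + m)))
        (R.transition (Nat.zero_le (i + m)) f₀)) : g * x = 0 := by
  refine hR.eq_zero_of_forall_mem_annihilatorImage hf₀ (fun m => ?_) ?_
  · rw [map_mul]
    exact Ideal.mul_mem_left _ _ (hx m)
  · rw [map_mul, hg.eval_zero, zero_mul]

/-- Elements of the small tilt killed by `g ^ 2` have all their components in the image of the
torsion of the tower. The `m`-th component is controlled through the `(m + 2)`-nd one, where it is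
only known up to multiples of a power of `g` that vanishes in the `m`-th component. -/
theorem mem_annihilatorImage_of_pow_two_mul_eq_zero
    (hI₁ : IsFirstPillar hR.toIsPurelyInseparable I₁) (hf₁ : I₁ = Ideal.span {f₁})
    (hg : IsTiltGenerator hR.toIsPurelyInseparable i f₁ g)
    {x : smallTilt hR.toIsPurelyInseparable i} (hx : g ^ 2 * x = 0) (m : ℕ) :
    smallTiltEval hR.toIsPurelyInseparable i m x ∈
      annihilatorImage (Ideal.Quotient.mk (R.extend I (i + m)))
        (R.transition (Nat.zero_le (i + m)) f₀) := by
  have hp2 : 2 ≤ p := (Fact.out : p.Prime).two_le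
  set F₀ := R.transition (Nat.zero_le (i + (m + 1) + 1)) f₀ with hF₀
  set F₁ := R.transition (Nat.le_add_left 1 (i + (m + 1))) f₁ with hF₁
  have hspan : R.extend I (i + (m + 1) + 1) = Ideal.span {F₀} := extend_eq_span_singleton hf₀ _
  have hpow : Ideal.span {F₁ ^ p} = Ideal.span {F₀} := by
    rw [← hspan, ← hI₁.map_transition_pow, hf₁, Ideal.map_span, Set.image_singleton,
      Ideal.span_singleton_pow]
  obtain ⟨v, hv⟩ := Ideal.mem_span_singleton'.mp (hpow ▸ Ideal.mem_span_singleton_self F₀)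
  obtain ⟨w, hw⟩ := Ideal.mem_span_singleton'.mp (hpow ▸ Ideal.mem_span_singleton_self (F₁ ^ p))
  obtain ⟨G, hG⟩ := Ideal.Quotient.mk_surjective (I := R.extend I (i + (m + 1) + 1))
    (smallTiltEval hR.toIsPurelyInseparable i (m + 1 + 1) g)
  obtain ⟨X, hX⟩ := Ideal.Quotient.mk_surjective (I := R.extend I (i + (m + 1) + 1))
    (smallTiltEval hR.toIsPurelyInseparable i (m + 1 + 1) x)
  have hGb : G ^ p ^ (m + 1) - F₁ ∈ R.extend I (i + (m + 1) + 1) := by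
    rw [← Ideal.Quotient.eq_zero_iff_mem, map_sub, map_pow, hG, sub_eq_zero]
    exact hg.eval_succ_pow (m + 1)
  have hXy : G ^ 2 * X ∈ R.extend I (i + (m + 1) + 1) := by
    rw [← Ideal.Quotient.eq_zero_iff_mem, map_mul, map_pow, hG, hX]
    have := congrArg (smallTiltEval hR.toIsPurelyInseparable i (m + 1 + 1)) hx
    rwa [map_mul, map_pow, map_zero] at this
  rw [hspan, Ideal.mem_span_singleton] at hGb hXy
  obtain ⟨b, hb⟩ := hGb
  obtain ⟨y, hy⟩ := hXy
  obtain ⟨e, z, c, he, hz, hexz⟩ := exists_mul_eq_add_of_pow_two_mul_eq hp2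
    (pow_pos (by omega : 0 < p) (m + 1)) hv.symm hw.symm (sub_eq_iff_eq_add'.mp hb) hy
  rw [← hspan] at he
  obtain ⟨e', he'⟩ := he.exists_left_inv
  obtain ⟨c', hc'⟩ := smallTiltEval_surjective (i := i) hR.frobProj_surjective (m + 1 + 1)
    (e' * Ideal.Quotient.mk _ c)
  have hxm : smallTiltEval hR.toIsPurelyInseparable i (m + 1 + 1)
      (x - g ^ (p ^ (m + 1) * p - 2) * c') ∈
      annihilatorImage (Ideal.Quotient.mk (R.extend I (i + (m + 1) + 1))) F₀ := by
    have h1 : smallTiltEval hR.toIsPurelyInseparable i (m + 1 + 1)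
        (x - g ^ (p ^ (m + 1) * p - 2) * c') = e' * Ideal.Quotient.mk _ z := by
      rw [map_sub, map_mul, map_pow, hc', ← hX, ← hG]
      have h2 := congrArg (Ideal.Quotient.mk (R.extend I (i + (m + 1) + 1))) hexz
      rw [map_mul, map_add, map_mul, map_pow] at h2
      refine Eq.trans (b := Ideal.Quotient.mk (R.extend I (i + (m + 1) + 1)) X -
        Ideal.Quotient.mk (R.extend I (i + (m + 1) + 1)) G ^ (p ^ (m + 1) * p - 2) *
          (e' * Ideal.Quotient.mk _ c)) rfl ?_
      linear_combination e' * h2 - Ideal.Quotient.mk _ X * he'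
    rw [h1]
    exact Ideal.mul_mem_left _ _ ((mem_annihilatorImage Ideal.Quotient.mk_surjective).mpr
      ⟨z, hz, rfl⟩)
  have h3 : frobProj hR.toIsPurelyInseparable (i + m) (frobProj hR.toIsPurelyInseparable
      (i + (m + 1)) (smallTiltEval hR.toIsPurelyInseparable i (m + 1 + 1)
        (x - g ^ (p ^ (m + 1) * p - 2) * c'))) ∈
      annihilatorImage (Ideal.Quotient.mk (R.extend I (i + m)))
        (R.transition (Nat.zero_le (i + m)) f₀) :=
    hR.frobProj_mem_annihilatorImage hf₀ (hR.frobProj_mem_annihilatorImage hf₀ hxm)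
  have h4 : smallTiltEval hR.toIsPurelyInseparable i m
      (x - g ^ (p ^ (m + 1) * p - 2) * c') = smallTiltEval hR.toIsPurelyInseparable i m x := by
    have h5 : p ^ m ≤ p ^ (m + 1) * p - 2 := by
      have h6 : 1 ≤ p ^ m := Nat.one_le_pow _ _ (by omega)
      have h7 : p ^ (m + 1) * p = p ^ m * (p * p) := by rw [pow_succ, mul_assoc]
      have h8 : p ^ m * 4 ≤ p ^ m * (p * p) := Nat.mul_le_mul_left _ (by nlinarith)
      omega
    rw [map_sub, map_mul, hg.eval_pow_of_le h5, zero_mul, sub_zero]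
  rwa [frobProj_smallTiltEval, frobProj_smallTiltEval, h4] at h3

/-- The `g`-torsion of the small tilt and the `f₀`-torsion of `R_i` have the same image in
`R_i / I R_i`. -/
theorem annihilatorImage_smallTiltEval (hI₁ : IsFirstPillar hR.toIsPurelyInseparable I₁)
    (hf₁ : I₁ = Ideal.span {f₁}) (hg : IsTiltGenerator hR.toIsPurelyInseparable i f₁ g) :
    annihilatorImage (smallTiltEval hR.toIsPurelyInseparable i 0) g =
      annihilatorImage (Ideal.Quotient.mk (R.extend I i)) (R.transition (Nat.zero_le i) f₀) := by
  ext y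
  rw [mem_annihilatorImage (smallTiltEval_surjective hR.frobProj_surjective 0)]
  constructor
  · rintro ⟨x, hx, rfl⟩
    exact hR.mem_annihilatorImage_of_pow_two_mul_eq_zero hf₀ hI₁ hf₁ hg
      (by rw [pow_two, mul_assoc, hx, mul_zero]) 0
  · intro hy
    obtain ⟨x, hx, hx0⟩ := exists_compatible_seq_of_surjective
      (E := fun m => annihilatorImage (Ideal.Quotient.mk (R.extend I (i + m)))
        (R.transition (Nat.zero_le (i + m)) f₀))
      (fun m z => ⟨frobProj hR.toIsPurelyInseparable (i + m) z.1,
        hR.frobProj_mem_annihilatorImage hf₀ z.2⟩)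
      (fun m z => by
        obtain ⟨w, hw, hwz⟩ := hR.exists_mem_annihilatorImage_frobProj_eq hf₀ z.2
        exact ⟨⟨w, hw⟩, Subtype.ext hwz⟩) 0 ⟨y, hy⟩
    let x' : smallTilt hR.toIsPurelyInseparable i :=
      ⟨fun m => (x m).1, fun m => congrArg Subtype.val (hx m)⟩
    exact ⟨x', hR.mul_eq_zero_of_forall_mem_annihilatorImage hf₀ hg fun m => (x m).2,
      congrArg Subtype.val hx0⟩

end IsPreperfectoid

end RingTower

/-! ### Morphisms of towers -/

namespace RingTower

variable {p : ℕ} [Fact p.Prime] {R : RingTower.{u}} {S : RingTower.{v}}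
  {I : Ideal (R.obj 0)} {J : Ideal (S.obj 0)}

theorem Hom.app_transition_of_one_le (α : Hom R S) {j : ℕ} (hj : 1 ≤ j) :
    (α.app j).comp (R.transition hj) = (S.transition hj).comp (α.app 1) := by
  induction j, hj using Nat.le_induction with
  | base => rw [R.transition_self, S.transition_self]; rfl
  | succ n hn ih =>
    rw [R.transition_succ hn, S.transition_succ hn, RingHom.comp_assoc, ← ih,
      ← RingHom.comp_assoc, ← RingHom.comp_assoc, α.comm]

theorem IsTiltGenerator.map {hR : R.IsPurelyInseparable p I} {hS : S.IsPurelyInseparable p J}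
    (α : Hom R S) (hα : I.map (α.app 0) ≤ J) {i : ℕ} {f₁ : R.obj 1} {g : smallTilt hR i}
    (hg : IsTiltGenerator hR i f₁ g) :
    IsTiltGenerator hS i (α.app 1 f₁) (α.tilt hR hS hα i g) where
  eval_zero := (congrArg (α.red hα (i + 0)) hg.eval_zero).trans (map_zero _)
  eval_one := (congrArg (α.red hα (i + 1)) hg.eval_one).trans <| Ideal.quotientMap_mk.trans <|
    congrArg _ (RingHom.congr_fun (α.app_transition_of_one_le (Nat.le_add_left 1 i)) f₁)

end RingTower

theorem mainTheorem5 (p : ℕ) [Fact p.Prime] (R : RingTower.{u}) (S : RingTower.{v})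
    (I₀ : Ideal (R.obj 0)) (J₀ : Ideal (S.obj 0))
    (hR : R.IsPreperfectoid p I₀) (hS : S.IsPreperfectoid p J₀)
    (I₁ : Ideal (R.obj 1)) (J₁ : Ideal (S.obj 1))
    (hI₁ : RingTower.IsFirstPillar hR.toIsPurelyInseparable I₁)
    (hJ₁ : RingTower.IsFirstPillar hS.toIsPurelyInseparable J₁)
    (α : RingTower.Hom R S)
    (h₀ : J₀ = I₀.map (α.app 0)) (h₁ : J₁ = I₁.map (α.app 1)) (i : ℕ)
    (hi : (IsNoetherianRing (R.obj i) ∧ IsNoetherianRing (S.obj i) ∧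
        (R.extend I₀ i).map (α.app i) ≤ Ideal.jacobson (⊥ : Ideal (S.obj i))) ∨
      (IsAdicComplete (R.extend I₀ i) (R.obj i) ∧ IsNoetherianRing (R.obj i) ∧
        IsAdicComplete ((R.extend I₀ i).map (α.app i)) (S.obj i))) :
    (α.app i).Flat ↔
      (α.tilt hR.toIsPurelyInseparable hS.toIsPurelyInseparable h₀.ge i).Flat := by
  subst h₀ h₁
  obtain ⟨⟨f₀, hf₀⟩⟩ := hR.isPrincipal
  obtain ⟨⟨f₁, hf₁⟩⟩ := hI₁.isPrincipal
  have hJ₀ : I₀.map (α.app 0) = Ideal.span {α.app 0 f₀} := by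
    rw [hf₀, Ideal.submodule_span_eq, Ideal.map_span, Set.image_singleton]
  have hJ₁' : I₁.map (α.app 1) = Ideal.span {α.app 1 f₁} := by
    rw [hf₁, Ideal.submodule_span_eq, Ideal.map_span, Set.image_singleton]
  have hφ : α.app i (R.transition (Nat.zero_le i) f₀) =
      S.transition (Nat.zero_le i) (α.app 0 f₀) := RingHom.congr_fun (α.app_transition i) f₀
  have hspan : (R.extend I₀ i).map (α.app i) =
      Ideal.span {α.app i (R.transition (Nat.zero_le i) f₀)} := by
    rw [RingTower.extend_eq_span_singleton hf₀, Ideal.map_span, Set.image_singleton]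
  have hNoeth : IsNoetherianRing (R.obj i) := hi.elim (fun h => h.1) fun h => h.2.1
  have hflat := RingHom.flat_iff_of_surjective_of_ker_eq_span_singleton (α.app i)
    (α.red (le_refl (I₀.map (α.app 0))) i) (Ideal.Quotient.mk (R.extend I₀ i))
    (Ideal.Quotient.mk (S.extend (I₀.map (α.app 0)) i)) (R.transition (Nat.zero_le i) f₀)
    Ideal.Quotient.mk_surjective Ideal.Quotient.mk_surjective
    (by rw [Ideal.mk_ker, RingTower.extend_eq_span_singleton hf₀])
    (by rw [Ideal.mk_ker, RingTower.extend_eq_span_singleton hJ₀, hφ])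
    (fun r => Ideal.quotientMap_mk.symm)
    (by
      rw [NoetherianOrComplete, ← hspan]
      exact hi.imp (fun h => ⟨h.2.1, h.2.2⟩) fun h => h.2.2)
    (by
      rw [hφ]
      exact hS.mul_eq_zero_of_pow_two_mul_eq_zero hJ₀ i)
  obtain ⟨g, hg⟩ := RingTower.exists_isTiltGenerator hI₁ hf₁ hR.frobProj_surjective i
  have hg' := hg.map (hS := hS.toIsPurelyInseparable) α (le_refl (I₀.map (α.app 0)))
  have hker := hg.ker_eval_zero hI₁ hf₁ hR.frobProj_surjective
  have hker' := hg'.ker_eval_zero hJ₁ hJ₁' hS.frobProj_surjective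
  have hann' := hS.annihilatorImage_smallTiltEval hJ₀ hJ₁ hJ₁' hg'
  have hsurj := RingTower.smallTiltEval_surjective (i := i) hR.frobProj_surjective 0
  have hRed : IsNoetherianRing (R.Red I₀ (i + 0)) :=
    isNoetherianRing_of_surjective (R.obj i) (R.Red I₀ i) (Ideal.Quotient.mk _)
      Ideal.Quotient.mk_surjective
  have hTilt := IsNoetherianRing.of_isAdicComplete_span_singleton
    (hg.isAdicComplete hI₁ hf₁ hR.frobProj_surjective) _ hsurj hker
  have htilt := RingHom.flat_iff_of_surjective_of_ker_eq_span_singleton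
    (α.tilt hR.toIsPurelyInseparable hS.toIsPurelyInseparable (le_refl (I₀.map (α.app 0))) i)
    (α.red (le_refl (I₀.map (α.app 0))) i)
    (RingTower.smallTiltEval hR.toIsPurelyInseparable i 0)
    (RingTower.smallTiltEval hS.toIsPurelyInseparable i 0) g hsurj
    (RingTower.smallTiltEval_surjective hS.frobProj_surjective 0) hker hker' (fun r => rfl)
    (Or.inr (hg'.isAdicComplete hJ₁ hJ₁' hS.frobProj_surjective))
    (fun s hs => hS.mul_eq_zero_of_forall_mem_annihilatorImage hJ₀ hg' fun m =>
      hS.mem_annihilatorImage_of_pow_two_mul_eq_zero hJ₀ hJ₁ hJ₁' hg' hs m)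
  have hannR := hR.annihilatorImage_smallTiltEval hf₀ hI₁ hf₁ hg
  -- Both sides of the equivalence reduce to the same condition on the reductions.
  rw [hflat, hφ]
  refine Iff.trans ?_ htilt.symm
  rw [hannR, hann']
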